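/- Let $\mathcal{R}=(\Sigma,E,L,\Gamma)$ be a rewriting logic theory: $\Sigma$ is a single-sorted ranked alphabet, $E$ a set of $\Sigma$-equations, and $\Gamma$ a set of conditional rewrite rules labelled by elements of $L$. Write $[t]$ for the class of a term $t$ modulo $E$. Let $$\varphi:\quad [t(\overline{x})]\to[t'(\overline{x})]\ \textbf{if}\ [a_1(\overline{x})]\to[b_1(\overline{x})]\wedge\dots\wedge[a_m(\overline{x})]\to[b_m(\overline{x})]$$ be a conditional rewrite rule over $(\Sigma,E)$ with variables among $\overline{x}=x_1,\dots,x_n$ ($n,m\ge 0$). *Models.* For functors $F_j,G_j:\mathcal{A}\to\mathcal{B}$ ($1\le j\le m$), the subequalizer $\mathrm{Subeq}((F_j,G_j)_j)$ is the category whose objects are the pairs $(A,(b_j)_j)$ with $A\in\mathcal{A}$ and $b_j:F_j(A)\to G_j(A)$, and whose morphisms $(A,(b_j)_j)\to(A',(b'_j)_j)$ are the $h:A\to A'$ in $\mathcal{A}$ with $G_j(h)\circ b_j=b'_j\circ F_j(h)$ for all $j$; $J$ denotes its projection functor to $\mathcal{A}$. An $\mathcal{R}$-system is a category $\mathcal{S}$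 with a functor $f_{\mathcal{S}}:\mathcal{S}^k\to\mathcal{S}$ for each $f\in\Sigma$ of arity $k$, such that the induced functors satisfy $u_{\mathcal{S}}=v_{\mathcal{S}}$ for every equation $u=v$ in $E$, and with, for each rule in $\Gamma$ of the form $[l]\to[r]$ if $[u_1]\to[v_1]\wedge\dots\wedge[u_q]\to[v_q]$ in $p$ variables, a natural transformation $l_{\mathcal{S}}\circ J_{\mathcal{S}}\Rightarrow r_{\mathcal{S}}\circ J_{\mathcal{S}}$, where $J_{\mathcal{S}}:\mathrm{Subeq}((u_{j\mathcal{S}},v_{j\mathcal{S}})_{1\le j\le q})\to\mathcal{S}^p$. An $\mathcal{R}$-system $\mathcal{S}$ satisfies an unconditional sequent $[t]\to[t']$ if there is a natural transformation $t_{\mathcal{S}}\Rightarrow t'_{\mathcal{S}}$, and it satisfies $\varphi$ if there is a natural transformation $t_{\mathcal{S}}\circ J_{\mathcal{S}}\Rightarrow t'_{\mathcal{S}}\circ J_{\mathcal{S}}$, where $J_{\mathcal{S}}:\mathrm{Subeq}((a_{j\mathcal{S}},b_{j\mathcal{S}})_{1\le j\le m})\to\mathcal{S}^n$. Write $\mathcal{R}\models\psi$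 if every $\mathcal{R}$-system satisfies $\psi$. *Deduction.* Write $\mathcal{R}\vdash[t]\to[t']$ if $[t]\to[t']$ is derivable by the following rules, for terms over a countably infinite set of variables. Reflexivity: $[t]\to[t]$. Transitivity: from $[t]\to[t']$ and $[t']\to[t'']$ infer $[t]\to[t'']$. Congruence: from $[t_i]\to[t'_i]$ for $1\le i\le k$ infer $[f(t_1,\dots,t_k)]\to[f(t'_1,\dots,t'_k)]$. Replacement: for a rule $[l(\overline{y})]\to[r(\overline{y})]$ if $\bigwedge_{j}[u_j(\overline{y})]\to[v_j(\overline{y})]$ in $\Gamma$ with $\overline{y}=y_1,\dots,y_p$, from $[w_i]\to[w'_i]$ ($1\le i\le p$) and $[u_j(\overline{w}/\overline{y})]\to[v_j(\overline{w}/\overline{y})]$ (all $j$) infer $[l(\overline{w}/\overline{y})]\to[r(\overline{w'}/\overline{y})]$. Let $\mathcal{R}(\overline{x})$ be $\mathcal{R}$ with $x_1,\dots,x_n$ added to the signature as new constants (the variables of $\Gamma$ being kept apart from them), and let $\mathcal{R}(\overline{x})\cup\{[a_j(\overline{x})]\to[b_j(\overline{x})]\}_{j}$ be obtained from it by adding the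 conditions of $\varphi$, now between ground terms, as unconditional rules with new labels. Then the following are equivalent: 1. $\mathcal{R}\models\varphi$, that is, $\mathcal{R}\models[t(\overline{x})]\to[t'(\overline{x})]\ \textbf{if}\ [a_1(\overline{x})]\to[b_1(\overline{x})]\wedge\dots\wedge[a_m(\overline{x})]\to[b_m(\overline{x})]$; 2. $\mathcal{R}(\overline{x})\cup\{[a_1(\overline{x})]\to[b_1(\overline{x})],\dots,[a_m(\overline{x})]\to[b_m(\overline{x})]\}\models[t(\overline{x})]\to[t'(\overline{x})]$; 3. $\mathcal{R}(\overline{x})\cup\{[a_1(\overline{x})]\to[b_1(\overline{x})],\dots,[a_m(\overline{x})]\to[b_m(\overline{x})]\}\vdash[t(\overline{x})]\to[t'(\overline{x})]$. -/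

import Mathlib

open CategoryTheory

universe u l v w

namespace RL

/-! ### Terms -/

/-- A (single-sorted) ranked alphabet of function symbols. -/
structure Signature where
  /-- The function symbols. -/
  Sym : Type u
  /-- The arity of each function symbol. -/
  arity : Sym → ℕ

/-- The terms over a signature with variables in `V`. -/
inductive Term (Sg : Signature.{u}) (V : Type) : Type u
  | var (x : V) : Term Sg V
  | app (f : Sg.Sym) (ts : Fin (Sg.arity f) → Term Sg V) : Term Sg V

/-- Simultaneous substitution. -/
def Term.subst {Sg : Signature.{u}} {V W : Type} (σ : V → Term Sg W) : Term Sg V → Term Sg W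
  | .var x => σ x
  | .app f ts => .app f (fun i => (ts i).subst σ)

/-- An equation `t(x₁, …, xₙ) = t'(x₁, …, xₙ)`. -/
structure Equation (Sg : Signature.{u}) where
  /-- The number of variables. -/
  n : ℕ
  lhs : Term Sg (Fin n)
  rhs : Term Sg (Fin n)

/-- An unconditional sequent `[t(x₁, …, xₙ)] → [t'(x₁, …, xₙ)]`, given by representatives of the
two classes of terms. -/
structure Sequent (Sg : Signature.{u}) where
  /-- The number of variables. -/
  n : ℕ
  lhs : Term Sg (Fin n)
  rhs : Term Sg (Fin n)

/-- A conditional rewrite rule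
`[t(x̄)] → [t'(x̄)] if [a₁(x̄)] → [b₁(x̄)] ∧ … ∧ [aₘ(x̄)] → [bₘ(x̄)]`, given by representatives of the
classes of terms; `x̄ = x₁, …, xₙ` contains all the variables that occur in the rule. -/
structure CondRule (Sg : Signature.{u}) where
  /-- The number of variables. -/
  n : ℕ
  lhs : Term Sg (Fin n)
  rhs : Term Sg (Fin n)
  /-- The number of conditions. -/
  m : ℕ
  condL : Fin m → Term Sg (Fin n)
  condR : Fin m → Term Sg (Fin n)

/-- A sequent as a rule without conditions. -/
def Sequent.toRule {Sg : Signature.{u}} (s : Sequent Sg) : CondRule Sg where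
  n := s.n
  lhs := s.lhs
  rhs := s.rhs
  m := 0
  condL := Fin.elim0
  condR := Fin.elim0

/-- A rewriting logic theory `(Σ, E, L, Γ)`: a set `E` of `Σ`-equations and a set `Γ` of
conditional rewrite rules labelled by elements of `L`. -/
structure RLTheory (Sg : Signature.{u}) (L : Type l) where
  /-- The equations `E`. -/
  eqs : Set (Equation Sg)
  /-- The labelled rules `Γ`. -/
  rules : Set (L × CondRule Sg)

/-! ### The calculus -/

/-- Provable equality of terms modulo a set `E` of equations. -/
inductive EqE {Sg : Signature.{u}} (E : Set (Equation Sg)) {V : Type} :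
    Term Sg V → Term Sg V → Prop
  | refl (t : Term Sg V) : EqE E t t
  | symm {t t' : Term Sg V} : EqE E t t' → EqE E t' t
  | trans {t t' t'' : Term Sg V} : EqE E t t' → EqE E t' t'' → EqE E t t''
  | congr (f : Sg.Sym) (ts ts' : Fin (Sg.arity f) → Term Sg V) :
      (∀ i, EqE E (ts i) (ts' i)) → EqE E (.app f ts) (.app f ts')
  | inst (e : Equation Sg) (he : e ∈ E) (σ : Fin e.n → Term Sg V) :
      EqE E (e.lhs.subst σ) (e.rhs.subst σ)

/-- Equality modulo `E` as an equivalence relation. -/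
def eqSetoid {Sg : Signature.{u}} (E : Set (Equation Sg)) (V : Type) : Setoid (Term Sg V) where
  r := EqE E
  iseqv := ⟨EqE.refl, EqE.symm, EqE.trans⟩

/-- The set of equivalence classes of terms modulo `E`. -/
def TermClass {Sg : Signature.{u}} (E : Set (Equation Sg)) (V : Type) : Type u :=
  Quotient (eqSetoid E V)

/-- The class `[t]` of a term. -/
def cls {Sg : Signature.{u}} (E : Set (Equation Sg)) {V : Type} (t : Term Sg V) :
    TermClass E V :=
  Quotient.mk (eqSetoid E V) t

/-- Derivability of `[t] → [t']`, for terms with variables in `V`, by the rules Reflexivity,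
Transitivity, Congruence and Replacement. -/
inductive Derives {Sg : Signature.{u}} {L : Type l} (R : RLTheory Sg L) {V : Type} :
    TermClass R.eqs V → TermClass R.eqs V → Prop
  | reflexivity (q : TermClass R.eqs V) : Derives R q q
  | transitivity {q q' q'' : TermClass R.eqs V} :
      Derives R q q' → Derives R q' q'' → Derives R q q''
  | congruence (f : Sg.Sym) (ts ts' : Fin (Sg.arity f) → Term Sg V) :
      (∀ i, Derives R (cls R.eqs (ts i)) (cls R.eqs (ts' i))) →
      Derives R (cls R.eqs (.app f ts)) (cls R.eqs (.app f ts'))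
  | replacement (r : L × CondRule Sg) (hr : r ∈ R.rules) (w w' : Fin r.2.n → Term Sg V) :
      (∀ i, Derives R (cls R.eqs (w i)) (cls R.eqs (w' i))) →
      (∀ j, Derives R (cls R.eqs ((r.2.condL j).subst w)) (cls R.eqs ((r.2.condR j).subst w))) →
      Derives R (cls R.eqs (r.2.lhs.subst w)) (cls R.eqs (r.2.rhs.subst w'))

/-- `R ⊢ [t] → [t']`: derivations use terms over the countable set `ℕ` of variables. -/
def RLTheory.Proves {Sg : Signature.{u}} {L : Type l} (R : RLTheory Sg L) (s : Sequent Sg) :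
    Prop :=
  Derives R (V := ℕ) (cls R.eqs (s.lhs.subst fun i => .var i.val))
    (cls R.eqs (s.rhs.subst fun i => .var i.val))

/-! ### Subequalizers -/

/-- The objects of the simultaneous subequalizer of the pairs of functors `F i, G i`. -/
structure Subeq {I : Type} {A : Type*} [Category A] {B : Type*} [Category B]
    (F G : I → (A ⥤ B)) where
  obj : A
  arr : ∀ i, (F i).obj obj ⟶ (G i).obj obj

namespace Subeq

variable {I : Type} {A : Type*} [Category A] {B : Type*} [Category B] {F G : I → (A ⥤ B)}

/-- The morphisms of the subequalizer. -/
@[ext]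
structure Hom (X Y : Subeq F G) where
  base : X.obj ⟶ Y.obj
  comm : ∀ i, X.arr i ≫ (G i).map base = (F i).map base ≫ Y.arr i

instance : Category (Subeq F G) where
  Hom := Hom
  id X := ⟨𝟙 X.obj, fun i => by simp⟩
  comp f g := ⟨f.base ≫ g.base, fun i => by
    rw [Functor.map_comp, Functor.map_comp, ← Category.assoc, f.comm, Category.assoc, g.comm,
      Category.assoc]⟩
  id_comp _ := Hom.ext (Category.id_comp _)
  comp_id _ := Hom.ext (Category.comp_id _)
  assoc _ _ _ := Hom.ext (Category.assoc _ _ _)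

variable (F G) in
/-- The subequalizer functor `J`. -/
def J : Subeq F G ⥤ A where
  obj X := X.obj
  map f := f.base
  map_id _ := rfl
  map_comp _ _ := rfl

end Subeq

/-! ### Systems and satisfaction -/

/-- A `Σ`-algebra structure on a category: a functor `Cⁿ ⥤ C` for each symbol of arity `n`. -/
structure CatAlgebra (Sg : Signature.{u}) (C : Type w) [Category.{v} C] where
  op : ∀ f : Sg.Sym, (Fin (Sg.arity f) → C) ⥤ C

/-- The functor `t_S` of a term `t` with variables in `V`. -/
def CatAlgebra.interp {Sg : Signature.{u}} {C : Type w} [Category.{v} C] (S : CatAlgebra Sg C)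
    {V : Type} : Term Sg V → ((V → C) ⥤ C)
  | .var x => Pi.eval (fun _ : V => C) x
  | .app f ts => Functor.pi' (fun i => S.interp (ts i)) ⋙ S.op f

/-- The subequalizer of the functors of the conditions of a rule. -/
abbrev CatAlgebra.CondSubeq {Sg : Signature.{u}} {C : Type w} [Category.{v} C]
    (S : CatAlgebra Sg C) (r : CondRule Sg) : Type (max v w) :=
  Subeq (fun j => S.interp (r.condL j)) (fun j => S.interp (r.condR j))

/-- The subequalizer functor `J_S` of a rule, with values in `Cⁿ`. -/
abbrev CatAlgebra.condJ {Sg : Signature.{u}} {C : Type w} [Category.{v} C]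
    (S : CatAlgebra Sg C) (r : CondRule Sg) : S.CondSubeq r ⥤ (Fin r.n → C) :=
  Subeq.J (fun j => S.interp (r.condL j)) (fun j => S.interp (r.condR j))

/-- The natural transformations `t_S ∘ J_S ⟹ t'_S ∘ J_S` attached to a rule. -/
abbrev CatAlgebra.RuleTrans {Sg : Signature.{u}} {C : Type w} [Category.{v} C]
    (S : CatAlgebra Sg C) (r : CondRule Sg) : Type (max v w) :=
  (S.condJ r ⋙ S.interp r.lhs) ⟶ (S.condJ r ⋙ S.interp r.rhs)

/-- An `R`-system structure on a category `C`. -/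
structure RSystem {Sg : Signature.{u}} {L : Type l} (R : RLTheory Sg L) (C : Type w)
    [Category.{v} C] extends CatAlgebra Sg C where
  eqs_hold : ∀ e ∈ R.eqs, toCatAlgebra.interp e.lhs = toCatAlgebra.interp e.rhs
  ruleTrans : ∀ r ∈ R.rules, toCatAlgebra.RuleTrans r.2

/-- Satisfaction of an unconditional sequent. -/
def CatAlgebra.SatisfiesSequent {Sg : Signature.{u}} {C : Type w} [Category.{v} C]
    (S : CatAlgebra Sg C) (s : Sequent Sg) : Prop :=
  Nonempty (S.interp s.lhs ⟶ S.interp s.rhs)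

/-- Satisfaction of a conditional rewrite rule. -/
def CatAlgebra.SatisfiesRule {Sg : Signature.{u}} {C : Type w} [Category.{v} C]
    (S : CatAlgebra Sg C) (r : CondRule Sg) : Prop :=
  Nonempty (S.RuleTrans r)

/-- `R ⊨ [t] → [t']`: every `R`-system satisfies the sequent. The categories considered have
their objects in a universe that contains the terms over the signature. -/
def RLTheory.EntailsSequent {Sg : Signature.{u}} {L : Type l} (R : RLTheory Sg L)
    (s : Sequent Sg) : Prop :=
  ∀ (C : Type (max u w)) [Category.{v} C] (S : RSystem R C), S.SatisfiesSequent s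

/-- `R ⊨ [t] → [t'] if C`: every `R`-system satisfies the conditional rule. -/
def RLTheory.EntailsRule {Sg : Signature.{u}} {L : Type l} (R : RLTheory Sg L)
    (r : CondRule Sg) : Prop :=
  ∀ (C : Type (max u w)) [Category.{v} C] (S : RSystem R C), S.SatisfiesRule r

/-! ### Variables as constants -/

/-- The signature `Σ(X)`: the elements of `X` are added as new constants. -/
def Signature.adjoin (Sg : Signature.{u}) (X : Type) : Signature.{u} where
  Sym := Sg.Sym ⊕ X
  arity := Sum.elim Sg.arity (fun _ => 0)

/-- A `Σ`-term as a `Σ(X)`-term with the same variables. -/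
def Term.incl {Sg : Signature.{u}} (X : Type) {V : Type} : Term Sg V → Term (Sg.adjoin X) V
  | .var x => .var x
  | .app f ts => .app (Sg := Sg.adjoin X) (Sum.inl f) (fun i => (ts i).incl X)

/-- The new constant of `Σ(X)` given by an element of `X`. -/
def newConst (Sg : Signature.{u}) {X V : Type} (x : X) : Term (Sg.adjoin X) V :=
  .app (Sg := Sg.adjoin X) (Sum.inr x) (fun i => Fin.elim0 i)

/-- A `Σ`-term with variables in `X` as a ground `Σ(X)`-term. -/
def Term.ground {Sg : Signature.{u}} {X : Type} (t : Term Sg X) : Term (Sg.adjoin X) (Fin 0) :=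
  (t.incl X).subst (newConst Sg)

/-- A `Σ`-equation as a `Σ(X)`-equation. -/
def Equation.incl {Sg : Signature.{u}} (X : Type) (e : Equation Sg) : Equation (Sg.adjoin X) where
  n := e.n
  lhs := e.lhs.incl X
  rhs := e.rhs.incl X

/-- A rule over `Σ` as a rule over `Σ(X)`. -/
def CondRule.incl {Sg : Signature.{u}} (X : Type) (r : CondRule Sg) : CondRule (Sg.adjoin X) where
  n := r.n
  lhs := r.lhs.incl X
  rhs := r.rhs.incl X
  m := r.m
  condL j := (r.condL j).incl X
  condR j := (r.condR j).incl X

/-- The theory `R(X)`. The variables of each equation and rule are bound to it, and so never clash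
with the new constants: no renaming is needed. -/
def RLTheory.adjoin {Sg : Signature.{u}} {L : Type l} (R : RLTheory Sg L) (X : Type) :
    RLTheory (Sg.adjoin X) L where
  eqs := Equation.incl X '' R.eqs
  rules := (fun r : L × CondRule Sg => (r.1, r.2.incl X)) '' R.rules

/-- The theory obtained by adding a family of unconditional sequents as new axioms, each with a
new label. -/
def RLTheory.addAxioms {Sg : Signature.{u}} {L : Type l} (R : RLTheory Sg L) {K : Type}
    (ax : K → Sequent Sg) : RLTheory Sg (L ⊕ K) where
  eqs := R.eqs
  rules := (fun r : L × CondRule Sg => (Sum.inl r.1, r.2)) '' R.rules ∪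
    Set.range (fun k => (Sum.inr k, (ax k).toRule))

/-- The conclusion `[t(x̄)] → [t'(x̄)]` of a rule as a ground sequent over `Σ(x̄)`. -/
def CondRule.groundConcl {Sg : Signature.{u}} (r : CondRule Sg) :
    Sequent (Sg.adjoin (Fin r.n)) where
  n := 0
  lhs := r.lhs.ground
  rhs := r.rhs.ground

/-- The condition `[aⱼ(x̄)] → [bⱼ(x̄)]` of a rule as a ground sequent over `Σ(x̄)`. -/
def CondRule.groundCond {Sg : Signature.{u}} (r : CondRule Sg) (j : Fin r.m) :
    Sequent (Sg.adjoin (Fin r.n)) where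
  n := 0
  lhs := (r.condL j).ground
  rhs := (r.condR j).ground

/-- The theory `R(x̄) ∪ {[a₁(x̄)] → [b₁(x̄)], …, [aₘ(x̄)] → [bₘ(x̄)]}`. -/
def RLTheory.withConds {Sg : Signature.{u}} {L : Type l} (R : RLTheory Sg L) (r : CondRule Sg) :
    RLTheory (Sg.adjoin (Fin r.n)) (L ⊕ Fin r.m) :=
  (R.adjoin (Fin r.n)).addAxioms r.groundCond

end RL

namespace RL

/-! A system for the extended theory is an `R`-system `S` together with a point of `Sⁿ` (the new
constants) and an arrow for each condition at that point, hence an object of the subequalizer of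
`φ`. The component there of a transformation for `φ` is an arrow between the two ground terms, which
gives 1 → 2. For 2 → 3, classes of terms preordered by derivability form a system in which an arrow
is exactly a derivation; thinness makes every naturality condition automatic. For 3 → 1, let `D` be
the subequalizer of `φ` in `S`. The functors `D ⥤ S`, preordered by existence of a natural
transformation, form an algebra for the extended signature once the constants denote the coordinates
of `J`. A ground term `t(x̄)` then has value `t_S ∘ J`, and the added axioms hold because the arrows
`bⱼ` carried by the objects of `D` are natural. Soundness of the calculus in preordered algebras
(`Derives.eval_le`) yields the transformation for `φ`. -/

variable {Sg : Signature.{u}}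

/-! ### Evaluation of terms in ordinary algebras -/

/-- The value of a term in an algebra with carrier `A`, under an assignment of the variables. -/
def Term.eval {A : Type*} (op : ∀ f : Sg.Sym, (Fin (Sg.arity f) → A) → A) {V : Type}
    (ρ : V → A) : Term Sg V → A
  | .var x => ρ x
  | .app f ts => op f (fun i => (ts i).eval op ρ)

theorem Term.eval_subst {A : Type*} (op : ∀ f : Sg.Sym, (Fin (Sg.arity f) → A) → A)
    {V W : Type} (σ : V → Term Sg W) (ρ : W → A) (t : Term Sg V) :
    (t.subst σ).eval op ρ = t.eval op (fun x => (σ x).eval op ρ) := by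
  induction t with
  | var x => rfl
  | app f ts ih => exact congrArg (op f) (funext ih)

/-- Preordered algebras that satisfy the equations and are closed under the rules of a theory
are sound for the calculus. -/
theorem Derives.eval_le {L : Type l} {R : RLTheory Sg L} {A : Type*}
    (op : ∀ f : Sg.Sym, (Fin (Sg.arity f) → A) → A) (le : A → A → Prop)
    (le_refl : ∀ a, le a a) (le_trans : ∀ {a b c}, le a b → le b c → le a c)
    (mono : ∀ f as bs, (∀ i, le (as i) (bs i)) → le (op f as) (op f bs))
    (eqs : ∀ e ∈ R.eqs, ∀ ρ, e.lhs.eval op ρ = e.rhs.eval op ρ)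
    (rules : ∀ r ∈ R.rules, ∀ ρ,
      (∀ j, le ((r.2.condL j).eval op ρ) ((r.2.condR j).eval op ρ)) →
      le (r.2.lhs.eval op ρ) (r.2.rhs.eval op ρ))
    {V : Type} (ρ : V → A) {t t' : Term Sg V}
    (h : Derives R (cls R.eqs t) (cls R.eqs t')) : le (t.eval op ρ) (t'.eval op ρ) := by
  have eval_eq : ∀ s s' : Term Sg V, EqE R.eqs s s' → s.eval op ρ = s'.eval op ρ := by
    intro s s' hs
    induction hs with
    | refl => rfl
    | symm _ ih => exact ih.symm
    | trans _ _ ih₁ ih₂ => exact ih₁.trans ih₂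
    | congr f ts ts' _ ih => exact congrArg (op f) (funext ih)
    | inst e he σ => rw [Term.eval_subst, Term.eval_subst, eqs e he]
  have eval_mono : ∀ {W : Type} (s : Term Sg W) (ρ₁ ρ₂ : W → A), (∀ x, le (ρ₁ x) (ρ₂ x)) →
      le (s.eval op ρ₁) (s.eval op ρ₂) := by
    intro W s ρ₁ ρ₂ hρ
    induction s with
    | var x => exact hρ x
    | app f ts ih => exact mono f _ _ ih
  -- Derivations relate classes, so evaluation descends to the quotient and the endpoints become
  -- arbitrary classes before the induction.
  let ev : TermClass R.eqs V → A := Quotient.lift (Term.eval op ρ) eval_eq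
  suffices H : ∀ q q', Derives R q q' → le (ev q) (ev q') from H _ _ h
  intro q q' hq
  induction hq with
  | reflexivity q => exact le_refl _
  | transitivity _ _ ih₁ ih₂ => exact le_trans ih₁ ih₂
  | congruence f ts ts' _ ih => exact mono f _ _ ih
  | replacement r hr w w' _ _ ih₁ ih₂ =>
    change le ((r.2.lhs.subst w).eval op ρ) ((r.2.rhs.subst w').eval op ρ)
    rw [Term.eval_subst, Term.eval_subst]
    -- Replacement splits into the rule at `w`, followed by monotonicity of the right-hand side from
    -- `w` to `w'`.
    refine le_trans (rules r hr _ fun j => ?_) (eval_mono _ _ _ ih₁)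
    rw [← Term.eval_subst, ← Term.eval_subst]
    exact ih₂ j

/-! ### Functors of terms -/

namespace CatAlgebra

/-- The algebra of functors from `D` to a categorical algebra. -/
def functorOp {C : Type*} [Category C] (S : CatAlgebra Sg C) (D : Type*) [Category D]
    (f : Sg.Sym) (Fs : Fin (Sg.arity f) → (D ⥤ C)) : D ⥤ C :=
  Functor.pi' Fs ⋙ S.op f

/-- This identifies values in the functor algebra with composites `t_S ∘ P`, so that soundness for
preordered algebras speaks of natural transformations. -/
theorem eval_functorOp {C : Type*} [Category C] (S : CatAlgebra Sg C) {D : Type*} [Category D]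
    {V : Type} (ρ : V → (D ⥤ C)) (t : Term Sg V) :
    t.eval (S.functorOp D) ρ = Functor.pi' ρ ⋙ S.interp t := by
  induction t with
  | var x => rfl
  | app f ts ih =>
    change Functor.pi' (fun i => (ts i).eval (S.functorOp D) ρ) ⋙ S.op f = _
    rw [funext ih]
    rfl

theorem interp_subst {C : Type*} [Category C] (S : CatAlgebra Sg C) {V W : Type}
    (σ : V → Term Sg W) (t : Term Sg V) :
    S.interp (t.subst σ) = Functor.pi' (fun x => S.interp (σ x)) ⋙ S.interp t := by
  induction t with
  | var x => rfl
  | app f ts ih =>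
    change Functor.pi' (fun i => S.interp ((ts i).subst σ)) ⋙ S.op f = _
    rw [funext ih]
    rfl

/-- The underlying `Σ`-algebra of a `Σ(X)`-algebra. -/
def reduct {C : Type*} [Category C] {X : Type} (S : CatAlgebra (Sg.adjoin X) C) :
    CatAlgebra Sg C where
  op f := S.op (Sum.inl f)

theorem interp_incl {C : Type*} [Category C] {X : Type} (S : CatAlgebra (Sg.adjoin X) C)
    {V : Type} (t : Term Sg V) : S.interp (t.incl X) = S.reduct.interp t := by
  induction t with
  | var x => rfl
  | app f ts ih =>
    change Functor.pi' (fun i => S.interp ((ts i).incl X)) ⋙ S.op (Sum.inl f) = _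
    rw [funext ih]
    rfl

theorem interp_ground {C : Type*} [Category C] {X : Type} (S : CatAlgebra (Sg.adjoin X) C)
    (t : Term Sg X) : S.interp t.ground =
      Functor.pi' (fun x => S.interp (newConst Sg x)) ⋙ S.reduct.interp t := by
  rw [Term.ground, interp_subst, interp_incl]

theorem ruleTrans_incl {C : Type*} [Category C] {X : Type} (S : CatAlgebra (Sg.adjoin X) C)
    (r : CondRule Sg) : S.RuleTrans (r.incl X) = S.reduct.RuleTrans r := by
  have h : (fun t : Term Sg (Fin r.n) => S.interp (t.incl X)) = S.reduct.interp :=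
    funext S.interp_incl
  -- Every occurrence of `interp` after `incl` is exposed as one and the same function, so that a
  -- single rewrite changes the dependent type throughout.
  change (Subeq.J (fun j => (fun t : Term Sg (Fin r.n) => S.interp (t.incl X)) (r.condL j))
      (fun j => (fun t : Term Sg (Fin r.n) => S.interp (t.incl X)) (r.condR j)) ⋙
        (fun t : Term Sg (Fin r.n) => S.interp (t.incl X)) r.lhs ⟶
    Subeq.J (fun j => (fun t : Term Sg (Fin r.n) => S.interp (t.incl X)) (r.condL j))
      (fun j => (fun t : Term Sg (Fin r.n) => S.interp (t.incl X)) (r.condR j)) ⋙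
        (fun t : Term Sg (Fin r.n) => S.interp (t.incl X)) r.rhs) = _
  rw [h]

end CatAlgebra

/-! ### From rules to ground sequents -/

/-- The underlying `R`-system of a system for `R(x̄)` with the conditions of a rule as axioms. -/
def RSystem.reduct {L : Type l} {R : RLTheory Sg L} {φ : CondRule Sg} {C : Type w}
    [Category.{v} C] (S : RSystem (R.withConds φ) C) : RSystem R C where
  toCatAlgebra := S.toCatAlgebra.reduct
  eqs_hold e he := by
    have h := S.eqs_hold (e.incl _) ⟨e, he, rfl⟩
    exact (S.interp_incl e.lhs).symm.trans (h.trans (S.interp_incl e.rhs))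
  ruleTrans r hr := cast (S.ruleTrans_incl r.2)
    (S.ruleTrans (Sum.inl r.1, r.2.incl _) (Or.inl ⟨_, ⟨r, hr, rfl⟩, rfl⟩))

theorem RLTheory.EntailsRule.entailsSequent {L : Type l} {R : RLTheory Sg L} {φ : CondRule Sg}
    (h : RLTheory.EntailsRule.{u, l, v, w} R φ) :
    RLTheory.EntailsSequent.{u, l, v, w} (R.withConds φ) φ.groundConcl := by
  intro C _ S
  obtain ⟨α⟩ := h C S.reduct
  let P : (Fin 0 → C) ⥤ (Fin φ.n → C) :=
    Functor.pi' fun x => S.interp (newConst Sg x)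
  let p : Fin 0 → C := fun i => i.elim0
  have cond : ∀ j, Nonempty ((S.reduct.interp (φ.condL j)).obj (P.obj p) ⟶
      (S.reduct.interp (φ.condR j)).obj (P.obj p)) := by
    intro j
    have β := S.ruleTrans (Sum.inr j, (φ.groundCond j).toRule) (Or.inr ⟨j, rfl⟩)
    -- An axiom has no conditions, so the empty family of arrows completes the unique point `p` to
    -- an object of its subequalizer.
    have b := β.app ⟨p, fun i => i.elim0⟩
    change (S.interp (φ.condL j).ground).obj p ⟶ (S.interp (φ.condR j).ground).obj p at b
    rw [S.interp_ground, S.interp_ground] at b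
    exact ⟨b⟩
  let a := α.app ⟨P.obj p, fun j => (cond j).some⟩
  change Nonempty (S.interp φ.lhs.ground ⟶ S.interp φ.rhs.ground)
  rw [S.interp_ground, S.interp_ground]
  -- The category `C⁰` has one object and one morphism, so the single arrow `a`, transported along
  -- `q = p`, is already a natural transformation.
  refine ⟨⟨fun q => eqToHom (by rw [Subsingleton.elim q p]; rfl) ≫ a ≫
    eqToHom (by rw [Subsingleton.elim q p]; rfl), fun q q' g => ?_⟩⟩
  obtain rfl : q = p := Subsingleton.elim _ _
  obtain rfl : q' = p := Subsingleton.elim _ _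
  obtain rfl : g = 𝟙 p := funext fun i => i.elim0
  simp

/-! ### The term model -/

section TermModel

variable {L : Type l} (R : RLTheory Sg L) (V : Type)

/-- The objects of the term model: the classes of terms, preordered by derivability. -/
structure TermModel : Type (max u w) where
  of ::
  class' : TermClass R.eqs V

/-- Lifting the proposition places the hom-sets in the prescribed universe `v`. -/
instance : Category.{v} (TermModel.{u, l, w} R V) where
  Hom X Y := ULift (PLift (Derives R X.class' Y.class'))
  id X := ⟨⟨.reflexivity _⟩⟩
  comp f g := ⟨⟨.transitivity f.down.down g.down.down⟩⟩

instance : Quiver.IsThin (TermModel.{u, l, w} R V) := fun _ _ =>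
  inferInstanceAs (Subsingleton (ULift (PLift _)))

variable {R V}

theorem cls_out (q : TermClass R.eqs V) : cls R.eqs (Quotient.out q) = q :=
  Quotient.out_eq q

variable (R V)

/-- The operations of the term model. -/
noncomputable def termAlgebra : CatAlgebra Sg (TermModel.{u, l, w} R V) where
  op f :=
    -- Representatives are chosen because Congruence is stated for families of terms; another choice
    -- gives the same class.
    { obj := fun X => ⟨cls R.eqs (.app f fun i => Quotient.out (X i).class')⟩
      map := fun g => ⟨⟨.congruence f _ _ fun i => by
        rw [cls_out, cls_out]
        exact (g i).down.down⟩⟩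
      map_id := fun _ => Subsingleton.elim _ _
      map_comp := fun _ _ => Subsingleton.elim _ _ }

variable {R V}

/-- The chosen representatives differ from the given terms only modulo `E`, and congruence of `EqE`
absorbs the difference. -/
theorem termAlgebra_interp_obj {W : Type} (t : Term Sg W) (σ : W → Term Sg V) :
    (((termAlgebra.{u, l, w, v} R V).interp t).obj fun x => ⟨cls R.eqs (σ x)⟩) =
      ⟨cls R.eqs (t.subst σ)⟩ := by
  induction t with
  | var x => rfl
  | app f ts ih =>
    refine congrArg TermModel.of (Quotient.sound (EqE.congr f _ _ fun i => ?_))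
    exact Quotient.exact ((cls_out _).trans (congrArg TermModel.class' (ih i)))

theorem termAlgebra_interp_obj' {W : Type} (t : Term Sg W) (X : W → TermModel.{u, l, w} R V) :
    ((termAlgebra.{u, l, w, v} R V).interp t).obj X =
      ⟨cls R.eqs (t.subst fun x => Quotient.out (X x).class')⟩ := by
  rw [← termAlgebra_interp_obj]
  congr 1
  funext x
  exact congrArg TermModel.of (cls_out _).symm

variable (R V)

/-- The term model as an `R`-system. -/
noncomputable def termSystem : RSystem R (TermModel.{u, l, w} R V) where
  toCatAlgebra := termAlgebra.{u, l, w, v} R V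
  eqs_hold e he := CategoryTheory.Functor.ext (fun X => by
      rw [termAlgebra_interp_obj', termAlgebra_interp_obj']
      exact congrArg TermModel.of (Quotient.sound (EqE.inst e he _)))
    (fun _ _ _ => Subsingleton.elim _ _)
  ruleTrans r hr :=
    { app := fun X => ⟨⟨by
        have hl := congrArg TermModel.class'
          (termAlgebra_interp_obj'.{u, l, v, w} r.2.lhs X.obj)
        have hr' := congrArg TermModel.class'
          (termAlgebra_interp_obj'.{u, l, v, w} r.2.rhs X.obj)
        change Derives R (((termAlgebra.{u, l, w, v} R V).interp r.2.lhs).obj X.obj).class'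
          (((termAlgebra.{u, l, w, v} R V).interp r.2.rhs).obj X.obj).class'
        rw [hl, hr']
        -- Only the component at `X` is needed, so Replacement is used with `w' = w`; its premises
        -- for the conditions are the arrows stored in `X`.
        refine .replacement r hr _ _ (fun _ => .reflexivity _) fun j => ?_
        have hj := (X.arr j).down.down
        rwa [termAlgebra_interp_obj', termAlgebra_interp_obj'] at hj⟩⟩
      naturality := fun _ _ _ => Subsingleton.elim _ _ }

end TermModel

/-- The component at the generic point, the tuple of classes of variables, is itself the required
derivation. -/
theorem RLTheory.EntailsSequent.proves {L : Type l} {R : RLTheory Sg L} {s : Sequent Sg}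
    (h : RLTheory.EntailsSequent.{u, l, v, w} R s) : R.Proves s := by
  obtain ⟨α⟩ := h (TermModel.{u, l, w} R ℕ) (termSystem.{u, l, v, w} R ℕ)
  have d := (α.app fun i => ⟨cls R.eqs (.var i.val)⟩).down.down
  change Derives R (((termAlgebra.{u, l, w, v} R ℕ).interp s.lhs).obj _).class'
    (((termAlgebra.{u, l, w, v} R ℕ).interp s.rhs).obj _).class' at d
  rwa [termAlgebra_interp_obj, termAlgebra_interp_obj] at d

/-! ### Soundness of ground derivations for rules -/

theorem Term.eval_incl {A : Type*} {X : Type}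
    (op : ∀ f : (Sg.adjoin X).Sym, (Fin ((Sg.adjoin X).arity f) → A) → A) {V : Type}
    (ρ : V → A) (t : Term Sg V) :
    (t.incl X).eval op ρ = t.eval (fun f => op (Sum.inl f)) ρ := by
  induction t with
  | var x => rfl
  | app f ts ih => exact congrArg (op (Sum.inl f)) (funext ih)

theorem Term.eval_ground {A : Type*} {X : Type}
    (op : ∀ f : (Sg.adjoin X).Sym, (Fin ((Sg.adjoin X).arity f) → A) → A) (κ : X → A)
    (hκ : ∀ x as, op (Sum.inr x) as = κ x) (ρ : Fin 0 → A) (t : Term Sg X) :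
    t.ground.eval op ρ = t.eval (fun f => op (Sum.inl f)) κ := by
  rw [Term.ground, Term.eval_subst, Term.eval_incl]
  congr 1
  funext x
  exact hκ x _

/-- A functor `P` together with transformations between the conditions over it lifts to the
subequalizer, so that a rule that holds in `S` holds over `P`. -/
theorem CatAlgebra.SatisfiesRule.comp {C : Type*} [Category C] {S : CatAlgebra Sg C}
    {r : CondRule Sg} (h : S.SatisfiesRule r) {D : Type*} [Category D]
    (P : D ⥤ (Fin r.n → C))
    (cond : ∀ j, Nonempty (P ⋙ S.interp (r.condL j) ⟶ P ⋙ S.interp (r.condR j))) :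
    Nonempty (P ⋙ S.interp r.lhs ⟶ P ⋙ S.interp r.rhs) := by
  obtain ⟨α⟩ := h
  let P' : D ⥤ S.CondSubeq r :=
    { obj := fun d => ⟨P.obj d, fun j => (cond j).some.app d⟩
      map := fun g => ⟨P.map g, fun j => ((cond j).some.naturality g).symm⟩
      map_id := fun d => Subeq.Hom.ext (P.map_id d)
      map_comp := fun f g => Subeq.Hom.ext (P.map_comp f g) }
  exact ⟨Functor.whiskerLeft P' α⟩

/-- Soundness is applied to functors on the subequalizer of `φ`, where the tuple of coordinates of
`J` is the universal point satisfying the conditions. -/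
theorem RLTheory.Proves.satisfiesRule {L : Type l} {R : RLTheory Sg L} {φ : CondRule Sg}
    (h : (R.withConds φ).Proves φ.groundConcl) {C : Type*} [Category C] (S : RSystem R C) :
    S.SatisfiesRule φ := by
  let D := S.CondSubeq φ
  let κ : Fin φ.n → (D ⥤ C) := fun x => S.condJ φ ⋙ Pi.eval _ x
  let op : ∀ f : (Sg.adjoin (Fin φ.n)).Sym,
      (Fin ((Sg.adjoin (Fin φ.n)).arity f) → (D ⥤ C)) → (D ⥤ C) := fun f =>
    match f with
    | Sum.inl f => S.functorOp D f
    | Sum.inr x => fun _ => κ x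
  have eval_incl : ∀ {V : Type} (ρ : V → (D ⥤ C)) (t : Term Sg V),
      (t.incl (Fin φ.n)).eval op ρ = Functor.pi' ρ ⋙ S.interp t := fun ρ t =>
    (t.eval_incl op ρ).trans (S.eval_functorOp ρ t)
  have eval_ground : ∀ (ρ : Fin 0 → (D ⥤ C)) (t : Term Sg (Fin φ.n)),
      t.ground.eval op ρ = S.condJ φ ⋙ S.interp t := fun ρ t =>
    (t.eval_ground op κ (fun _ _ => rfl) ρ).trans (S.eval_functorOp κ t)
  -- Equalities of functors are used only through existence of transformations, which avoids
  -- transport along them.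
  have hom_ground : ∀ (ρ : Fin 0 → (D ⥤ C)) (t t' : Term Sg (Fin φ.n)),
      Nonempty (t.ground.eval op ρ ⟶ t'.ground.eval op ρ) ↔
        Nonempty (S.condJ φ ⋙ S.interp t ⟶ S.condJ φ ⋙ S.interp t') := fun ρ t t' => by
    rw [eval_ground, eval_ground]
  have hom_incl : ∀ {V : Type} (ρ : V → (D ⥤ C)) (t t' : Term Sg V),
      Nonempty ((t.incl (Fin φ.n)).eval op ρ ⟶ (t'.incl (Fin φ.n)).eval op ρ) ↔
        Nonempty (Functor.pi' ρ ⋙ S.interp t ⟶ Functor.pi' ρ ⋙ S.interp t') :=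
    fun ρ t t' => by rw [eval_incl, eval_incl]
  have key := Derives.eval_le (R := R.withConds φ) op (fun F G => Nonempty (F ⟶ G))
    (fun F => ⟨𝟙 F⟩) (fun ⟨α⟩ ⟨β⟩ => ⟨α ≫ β⟩) ?_ ?_ ?_
    -- The variables in `ℕ` need some value; any functor serves, since the endpoints are ground.
    (fun _ => S.condJ φ ⋙ S.interp φ.lhs) h
  · rw [Term.eval_subst, Term.eval_subst] at key
    exact (hom_ground _ _ _).1 key
  · rintro (f | x) Fs Gs hFG
    · let α : Functor.pi' Fs ⟶ Functor.pi' Gs :=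
        { app := fun d i => (hFG i).some.app d
          naturality := fun _ _ g => funext fun i => (hFG i).some.naturality g }
      exact ⟨Functor.whiskerRight α (S.op f)⟩
    · exact ⟨𝟙 _⟩
  · rintro _ ⟨e, he, rfl⟩ ρ
    exact (eval_incl ρ e.lhs).trans
      ((congrArg (Functor.pi' ρ ⋙ ·) (S.eqs_hold e he)).trans (eval_incl ρ e.rhs).symm)
  · rintro _ (⟨_, ⟨r, hr, rfl⟩, rfl⟩ | ⟨j, rfl⟩) ρ hρ
    -- A rule of `R` holds at any tuple of functors, by lifting the tuple to the subequalizer of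
    -- that rule.
    · exact (hom_incl ρ r.2.lhs r.2.rhs).2 (CatAlgebra.SatisfiesRule.comp ⟨S.ruleTrans r hr⟩ _
        fun j => (hom_incl ρ (r.2.condL j) (r.2.condR j)).1 (hρ j))
    -- The added axiom holds through the arrows `bⱼ`: their naturality is the defining condition on
    -- morphisms of the subequalizer.
    · exact (hom_ground ρ (φ.condL j) (φ.condR j)).2
        ⟨⟨fun X => X.arr j, fun _ _ g => (g.comm j).symm⟩⟩

end RL

theorem proposition8 {Sg : RL.Signature.{u}} {L : Type l} (R : RL.RLTheory Sg L)
    (φ : RL.CondRule Sg) :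
    List.TFAE
      [RL.RLTheory.EntailsRule.{u, l, v, w} R φ,
        RL.RLTheory.EntailsSequent.{u, l, v, w} (R.withConds φ) φ.groundConcl,
        (R.withConds φ).Proves φ.groundConcl] := by
  tfae_have 1 → 2 := RL.RLTheory.EntailsRule.entailsSequent
  tfae_have 2 → 3 := RL.RLTheory.EntailsSequent.proves
  tfae_have 3 → 1 := fun h _ _ S => h.satisfiesRule S
  tfae_finish
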